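/- **Setting.** A network has one server, $H$ relays and $K$ users; relay $i$ is connected to the users in $\mathcal N_i\subseteq[K]$, with $\bigcup_i\mathcal N_i=[K]$ and $\mathcal N_i\neq[K]$ for all $i$. Let $r_k$ be the number of relays connected to user $k$; the average user connectivity is $\frac1K\sum_k r_k$, and $\mathcal I_z=\{k: r_k=z\}$. User $k$ holds an intermediate value (IV) $\mathbf v_k$ of $V\ge 1$ bits. It sends a function of $\mathbf v_k$ to its relays, from which relay $i$ obtains a set $\mathcal V_i$ of local IVs of users in $\mathcal N_i$. Relay $i$ sends a $T_i$-bit function $X_i$ of the messages it received to the server; the server broadcasts a $T_0$-bit function $X_0$ of $(X_1,\dots,X_H)$ to all relays; from $X_0$ and $\mathcal V_i$ each relay $i$ must recover all of $(\mathbf v_1,\dots,\mathbf v_K)$ and sends a message to its users, from which each user $k$ must recover $\mathbf w_k$, where $(\mathbf w_1,\dots,\mathbf w_K)=\phi(\mathbf v_1,\dots,\mathbf v_K)$ and $\phi$ is a given (arbitrary) global update function (one for each $V$). All recoveries must be correct for all values of the IVs. The loads are $L_{up}=\sum_i T_i/V$ and $L_{down}=T_0/V$; a pair is achievable if it is the load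 pair of such a scheme for some $V\ge1$. $L^*_{up}$ and $L^*_{down}$ denote the least achievable uplink and downlink loads. **Coded scheme.** Users send their IVs uncoded. In round $z=1,\dots,H-1$ let $n_i^z=|\mathcal N_i\cap\mathcal I_z|-\min_{j\in[H]}|\mathcal N_i\cap\mathcal N_j\cap\mathcal I_z|$, and let $(\alpha_i^z)_i$ be an optimal solution of: minimize $\sum_i n_i^z\alpha_i$ subject to $\sum_{i:k\in\mathcal N_i}\alpha_i\ge1$ for all $k\in[K]$ and $0\le\alpha_i\le1$. Each $\mathbf v_k$ with $k\in\mathcal I_z$ is cut into segments $\mathbf v_{k,i}$ of $\alpha_i^zV$ bits ($i$ with $k\in\mathcal N_i$) which together make up $\mathbf v_k$, and relay $i$ sends $n_i^z$ linear combinations of the segments $\mathbf v_{k,i}$, $k\in\mathcal N_i\cap\mathcal I_z$. For some $\alpha^z$ with $1/\alpha^z$ a positive integer and all $\alpha_i^z/\alpha^z$ integers, the server cuts the received messages of round $z$ into pieces of $\alpha^zV$ bits and broadcasts $\frac1{\alpha^z}\big(|\mathcal I_z|-\min_i|\mathcal I_z\cap\mathcal N_i|\big)$ linear combinations of them. Linear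 combinations are symbol-wise over the field with $2^{\alpha^zV}$ elements; their coefficients are to be chosen so that all relays can decode. **Symmetric design.** The users are divided into $\binom Hr$ groups of equal positive size, one for each $r$-subset $\mathcal T\subseteq[H]$, and each user of the group of $\mathcal T$ is connected exactly to the relays in $\mathcal T$. **Theorem.** Let $1\le r<H$ and let $K\ge1$ be divisible by $\binom Hr$. Symmetric designs exist. Every symmetric design has average user connectivity $r$, and for every such design and every $\phi$: 1. For all sufficiently large $m$, with $V=rm$, there are coefficients for which the coded scheme is a valid scheme. Whenever the coded scheme is valid, for any $V\ge1$, its loads are $L_{up}=\frac{K(H-r)}{H-1}$ and $L_{down}=K-\frac{rK}{H}$. 2. These loads are therefore achieved simultaneously, and they are optimal for this network: $L_{up}=L^*_{up}=\frac{K(H-r)}{H-1}$ and $L_{down}=L^*_{down}=K-\frac{rK}{H}$. 3. They are also the least uplink load and the least downlink load achievable on any network with $H$ relays, $K$ users and average user connectivity $r$. -/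

import Mathlib

noncomputable section

/-- Messages of `n` bits (the paper's alphabet with `2 ^ n` elements). -/
abbrev Bits (n : ℕ) : Type := Fin n → ZMod 2

/-- A two-hop network with `H` relays and `K` users. `N i` is the set of users connected to
relay `i`. Every user is connected to some relay, and no relay is connected to all users. -/
structure Network (H K : ℕ) where
  N : Fin H → Finset (Fin K)
  cover : ∀ k, ∃ i, k ∈ N i
  nontrivial : ∀ i, N i ≠ Finset.univ

namespace Network

variable {H K : ℕ}

/-- The relays to which user `k` is connected. -/
def relays (G : Network H K) (k : Fin K) : Finset (Fin H) :=
  Finset.univ.filter fun i => k ∈ G.N i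

/-- The average user connectivity: the number of links divided by the number of users. -/
def avgConnectivity (G : Network H K) : ℝ :=
  (∑ k, ((G.relays k).card : ℝ)) / K

/-- The users connected to exactly `z` relays. -/
def usersOf (G : Network H K) (z : ℕ) : Finset (Fin K) :=
  Finset.univ.filter fun k => (G.relays k).card = z

/-- The symmetric (combination network) design: the users are divided into groups of one common
size `η ≥ 1`, one group for each `r`-subset `T` of the relays, and the users of the group of `T`
are connected to exactly the relays in `T`. -/
def IsSymmetricDesign (G : Network H K) (r : ℕ) : Prop :=
  (∀ k, (G.relays k).card = r) ∧
    ∃ η : ℕ, 0 < η ∧ ∀ T : Finset (Fin H), T.card = r →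
      (Finset.univ.filter fun k => G.relays k = T).card = η

/-- The number of combinations sent by relay `i` in round `z`:
`|N_i ∩ I_z| - min_j |N_i ∩ N_j ∩ I_z|` (the minimum is over all relays `j`, and `j = i` shows
that the subtraction does not truncate). -/
def upCount (G : Network H K) (z : ℕ) (i : Fin H) : ℕ :=
  (G.N i ∩ G.usersOf z).card - ⨅ j : Fin H, (G.N i ∩ G.N j ∩ G.usersOf z).card

/-- `|I_z| - min_i |I_z ∩ N_i|`. -/
def downCount (G : Network H K) (z : ℕ) : ℕ :=
  (G.usersOf z).card - ⨅ i : Fin H, (G.usersOf z ∩ G.N i).card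

/-- Constraints of the linear program that determines the fractions `α_i` of a round. -/
def IsFeasible (G : Network H K) (α : Fin H → ℝ) : Prop :=
  (∀ k, 1 ≤ ∑ i, α i * (if k ∈ G.N i then 1 else 0)) ∧ ∀ i, 0 ≤ α i ∧ α i ≤ 1

/-- Objective of that linear program in round `z`. -/
def objective (G : Network H K) (z : ℕ) (α : Fin H → ℝ) : ℝ :=
  ∑ i, (G.upCount z i : ℝ) * α i

/-- `α` is an optimal solution of the linear program of round `z`. -/
def IsOptimalSplit (G : Network H K) (z : ℕ) (α : Fin H → ℝ) : Prop :=
  G.IsFeasible α ∧ ∀ α' : Fin H → ℝ, G.IsFeasible α' → G.objective z α ≤ G.objective z α'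

end Network

/-- The communication rounds `z = 1, …, H - 1`. -/
abbrev Round (H : ℕ) : Type := {z : ℕ // z ∈ Finset.Icc 1 (H - 1)}

/-- A global update function for each bit size `V` of the intermediate values. -/
abbrev GlobalUpdate (K : ℕ) : Type := (V : ℕ) → (Fin K → Bits V) → (Fin K → Bits V)

/-- A communication scheme on the network `G`, for intermediate values (IVs) of `V` bits and the
global update function `φ`: all encoders and decoders, error-free for all values of the IVs. -/
structure Scheme {H K : ℕ} (G : Network H K) (V : ℕ)
    (φ : (Fin K → Bits V) → (Fin K → Bits V)) where
  /-- bits sent by user `k` -/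
  TU : Fin K → ℕ
  /-- bits sent by relay `i` to the server -/
  T : Fin H → ℕ
  /-- bits broadcast by the server -/
  T₀ : ℕ
  /-- bits sent by relay `i` to its users -/
  TE : Fin H → ℕ
  /-- the indices of the local IVs which relay `i` obtains from its users -/
  loc : Fin H → Finset (Fin K)
  loc_subset : ∀ i, loc i ⊆ G.N i
  userEnc : (k : Fin K) → Bits V → Bits (TU k)
  localDec : (i : Fin H) → ((k : {k // k ∈ G.N i}) → Bits (TU k)) → ({k // k ∈ loc i} → Bits V)
  relayEnc : (i : Fin H) → ((k : {k // k ∈ G.N i}) → Bits (TU k)) → Bits (T i)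
  serverEnc : ((i : Fin H) → Bits (T i)) → Bits T₀
  relayDec : (i : Fin H) → Bits T₀ → ({k // k ∈ loc i} → Bits V) → (Fin K → Bits V)
  relayDownEnc : (i : Fin H) → Bits T₀ → ({k // k ∈ loc i} → Bits V) → Bits (TE i)
  userDec : (k : Fin K) → ((i : {i // k ∈ G.N i}) → Bits (TE i)) → Bits V
  /-- the local IVs are obtained correctly -/
  localDec_correct : ∀ (v : Fin K → Bits V) (i : Fin H) (k : {k // k ∈ loc i}),
    localDec i (fun l => userEnc l (v l)) k = v k
  /-- every relay recovers all IVs from the server's message and its local IVs -/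
  relayDec_correct : ∀ (v : Fin K → Bits V) (i : Fin H),
    relayDec i (serverEnc fun j => relayEnc j fun l => userEnc l (v l))
      (localDec i fun l => userEnc l (v l)) = v
  /-- every user recovers its updated model -/
  userDec_correct : ∀ (v : Fin K → Bits V) (k : Fin K),
    userDec k (fun i => relayDownEnc i (serverEnc fun j => relayEnc j fun l => userEnc l (v l))
      (localDec i fun l => userEnc l (v l))) = φ v k

namespace Scheme

variable {H K : ℕ} {G : Network H K} {V : ℕ} {φ : (Fin K → Bits V) → (Fin K → Bits V)}

/-- The message from relay `i` to the server when the IVs are `v`. -/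
def upMsg (S : Scheme G V φ) (v : Fin K → Bits V) (i : Fin H) : Bits (S.T i) :=
  S.relayEnc i fun l => S.userEnc l (v l)

/-- The message broadcast by the server when the IVs are `v`. -/
def downMsg (S : Scheme G V φ) (v : Fin K → Bits V) : Bits S.T₀ :=
  S.serverEnc (S.upMsg v)

/-- The uplink communication load from the relays to the server. -/
def upLoad (S : Scheme G V φ) : ℝ := (∑ i, (S.T i : ℝ)) / V

/-- The downlink communication load from the server to the relays. -/
def downLoad (S : Scheme G V φ) : ℝ := (S.T₀ : ℝ) / V

end Scheme

namespace Network

variable {H K : ℕ}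

/-- The load pair `(Lup, Ldown)` between relays and server is achievable. -/
def Achievable (G : Network H K) (φ : GlobalUpdate K) (Lup Ldown : ℝ) : Prop :=
  ∃ V : ℕ, 0 < V ∧ ∃ S : Scheme G V (φ V), S.upLoad = Lup ∧ S.downLoad = Ldown

/-- All achievable uplink loads; the optimal uplink load is the least element. -/
def upLoads (G : Network H K) (φ : GlobalUpdate K) : Set ℝ :=
  {L | ∃ L', G.Achievable φ L L'}

/-- All achievable downlink loads; the optimal downlink load is the least element. -/
def downLoads (G : Network H K) (φ : GlobalUpdate K) : Set ℝ :=
  {L | ∃ L', G.Achievable φ L' L}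

end Network

/-- The parameters of the coded scheme. In round `z` an IV of `V` bits is cut into `q z`
consecutive symbols of `b z` bits, each identified with an element of the field with `2 ^ b z`
elements (so `1 / q z` is the paper's downlink fraction `α^z`). -/
structure CodingParams {H K : ℕ} (G : Network H K) (V : ℕ) where
  /-- relay `i` is responsible for `α z i * V` bits of each of its IVs of round `z` -/
  α : Round H → Fin H → ℝ
  optimal : ∀ z : Round H, G.IsOptimalSplit z (α z)
  /-- symbols per IV -/
  q : Round H → ℕ
  /-- bits per symbol -/
  b : Round H → ℕ
  size : ∀ z, q z * b z = V
  /-- symbols per segment of relay `i` -/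
  s : Round H → Fin H → ℕ
  seg_size : ∀ z i, (s z i : ℝ) = α z i * q z
  ident : (z : Round H) → Bits (b z) ≃ₗ[ZMod 2] GaloisField 2 (b z)
  /-- the positions in `v_k` of the symbols of the segment `v_{k,i}` -/
  seg : (z : Round H) → Fin K → (i : Fin H) → Fin (s z i) → Fin (q z)
  /-- the segments of the relays connected to `k` make up the whole IV (when their sizes add up
  to `V`, this forces the segments to be disjoint) -/
  seg_cover : ∀ (z : Round H) (k : Fin K), k ∈ G.usersOf z → ∀ p : Fin (q z),
    ∃ i, k ∈ G.N i ∧ ∃ t, seg z k i t = p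
  /-- coefficients of the linear combinations formed by the relays -/
  c : (z : Round H) → (i : Fin H) → Fin (G.upCount z i) → Fin K → GaloisField 2 (b z)
  /-- coefficients of the linear combinations formed by the server -/
  d : (z : Round H) → Fin (q z * G.downCount z) → (i : Fin H) → Fin (G.upCount z i) →
    Fin (s z i) → GaloisField 2 (b z)

namespace CodingParams

variable {H K : ℕ} {G : Network H K} {V : ℕ}

/-- The `p`-th symbol of the IV `x` in round `z`. -/
def symbol (P : CodingParams G V) (z : Round H) (x : Bits V) (p : Fin (P.q z)) :
    GaloisField 2 (P.b z) :=
  P.ident z fun u => x (Fin.cast (P.size z) (finProdFinEquiv (p, u)))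

/-- The `t`-th symbol of the `j`-th linear combination of relay `i` in round `z`, a combination
of the segments `v_{k,i}` with `k ∈ N_i ∩ I_z`. -/
def upSymbol (P : CodingParams G V) (v : Fin K → Bits V) (z : Round H) (i : Fin H)
    (j : Fin (G.upCount z i)) (t : Fin (P.s z i)) : GaloisField 2 (P.b z) :=
  ∑ k ∈ G.N i ∩ G.usersOf z, P.c z i j k * P.symbol z (v k) (P.seg z k i t)

/-- The `n`-th linear combination of the server in round `z`, a combination of the symbols
received from the relays in that round. -/
def downSymbol (P : CodingParams G V) (v : Fin K → Bits V) (z : Round H)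
    (n : Fin (P.q z * G.downCount z)) : GaloisField 2 (P.b z) :=
  ∑ i, ∑ j, ∑ t, P.d z n i j t * P.upSymbol v z i j t

end CodingParams

namespace Scheme

variable {H K : ℕ} {G : Network H K} {V : ℕ} {φ : (Fin K → Bits V) → (Fin K → Bits V)}

/-- `S` is an instance of the coded scheme: each user sends its IV uncoded; each relay sends,
over all rounds `z = 1, …, H - 1`, its linear combinations; the server sends its linear
combinations of the received symbols. The bijections `lay` and `lay₀` list the bits of a message
by round, combination, symbol and bit within the symbol. -/
def IsCoded (S : Scheme G V φ) : Prop :=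
  ∃ P : CodingParams G V,
    (∃ hT : ∀ k, S.TU k = V, ∀ (k : Fin K) (x : Bits V) (t : Fin V),
      S.userEnc k x (Fin.cast (hT k).symm t) = x t) ∧
    (∀ i, ∃ lay : Fin (S.T i) ≃
        (Σ z : Round H, Fin (G.upCount z i) × Fin (P.s z i) × Fin (P.b z)),
      ∀ (v : Fin K → Bits V) (z : Round H) (j : Fin (G.upCount z i)) (t : Fin (P.s z i)),
        P.ident z (fun u => S.upMsg v i (lay.symm ⟨z, j, t, u⟩)) = P.upSymbol v z i j t) ∧
    (∃ lay₀ : Fin S.T₀ ≃ (Σ z : Round H, Fin (P.q z * G.downCount z) × Fin (P.b z)),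
      ∀ (v : Fin K → Bits V) (z : Round H) (n : Fin (P.q z * G.downCount z)),
        P.ident z (fun u => S.downMsg v (lay₀.symm ⟨z, n, u⟩)) = P.downSymbol v z n)

end Scheme

end

/-!
Lower bounds. Relay `i` recovers all `K` IVs from the broadcast and the IVs in `N i`, so the
broadcast carries at least `K - #(N i)` IVs. The broadcast is a function of the uplink messages,
and that of relay `i` is a function of the IVs in `N i`, so the other relays together also send at
least `K - #(N i)` IVs. Averaging over `i` turns `∑ i, #(N i)` into the average connectivity.

Achievability. All coefficients are taken from Vandermonde matrices, in which any `n` columns of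
the first `n` rows are linearly independent. Relay `l` therefore first recovers all uplink symbols
of a round, because the server sends at least as many combinations as there are symbols from the
other relays, and then the segments `v_{k,i}`, because at most `upCount z i` users of relay `i`
are unknown to relay `l`. In a symmetric design only the round `z = r` is not empty, and double
counting of the users connected to a given set of relays gives
`(H - 1) * upCount = r * downCount`, which is the count needed for the splitting `α = 1 / r`. This
splitting is optimal since `upCount` is proportional to `#(N i)` and every feasible `α` satisfies
`K ≤ ∑ i, #(N i) * α i`.
-/

open Finset

theorem card_mul_le_sum_add_card_mul {κ ι : Type*} [Fintype κ] [Fintype ι] {V : ℕ} {n : ι → ℕ}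
    (s : Finset κ) (M : (κ → Bits V) → (j : ι) → Bits (n j))
    (hM : ∀ v v', M v = M v' → (∀ k ∈ s, v k = v' k) → v = v') :
    Fintype.card κ * V ≤ ∑ j, n j + #s * V := by
  classical
  have hinj : Function.Injective fun v => (M v, s.restrict v) := fun v v' h =>
    hM v v' (Prod.ext_iff.1 h).1 fun k hk => congrFun (Prod.ext_iff.1 h).2 ⟨k, hk⟩
  have hcard := Fintype.card_le_of_injective _ hinj
  simp only [Fintype.card_prod, Fintype.card_fun, Fintype.card_pi, Fintype.card_fin, ZMod.card,
    Fintype.card_coe, prod_pow_eq_pow_sum, ← pow_mul, ← pow_add] at hcard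
  have hexp := (Nat.pow_le_pow_iff_right one_lt_two).1 hcard
  linarith

theorem eq_of_forall_sum_pow_mul_eq {R κ : Type*} [CommRing R] [IsDomain R] {S E : Finset κ}
    {a : κ → R} (ha : Set.InjOn a S) {n : ℕ} (hE : #E ≤ n) {x y : κ → R}
    (hxy : ∀ k ∈ S, k ∉ E → x k = y k)
    (h : ∀ j : Fin n, ∑ k ∈ S, a k ^ (j : ℕ) * x k = ∑ k ∈ S, a k ^ (j : ℕ) * y k) :
    ∀ k ∈ S, x k = y k := by
  classical
  intro k hk
  by_cases hkE : k ∈ E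
  · let e := (S ∩ E).equivFin.symm
    have hmoment : ∀ j : Fin #(S ∩ E),
        ∑ l, (x (e l) - y (e l)) * a (e l) ^ (j : ℕ) = 0 := fun j => by
      have hj := h ⟨j, j.2.trans_le ((card_le_card inter_subset_right).trans hE)⟩
      rw [← sub_eq_zero, ← sum_sub_distrib] at hj
      rw [e.sum_comp fun k => (x k - y k) * a k ^ (j : ℕ),
        sum_coe_sort (S ∩ E) fun k => (x k - y k) * a k ^ (j : ℕ), ← hj]
      refine sum_subset_zero_on_sdiff inter_subset_left (fun k hk => ?_) fun k _ => by ring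
      obtain ⟨hkS, hkE⟩ := by simpa using hk
      rw [hxy k hkS hkE, sub_self]
    have hzero := Matrix.eq_zero_of_forall_pow_sum_mul_pow_eq_zero (f := fun l => a (e l))
      (fun l l' hl => e.injective <| Subtype.ext <|
        ha (mem_inter.1 (e l).2).1 (mem_inter.1 (e l').2).1 hl) hmoment
    simpa [e, sub_eq_zero] using congrFun hzero (e.symm ⟨k, mem_inter.2 ⟨hk, hkE⟩⟩)
  · exact hxy k hk hkE

theorem exists_injective_galoisField {α : Type*} [Fintype α] {p n : ℕ} [Fact p.Prime]
    (hn : n ≠ 0) (hα : Fintype.card α ≤ p ^ n) :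
    ∃ a : α → GaloisField p n, Function.Injective a := by
  have := Fintype.ofFinite (GaloisField p n)
  rw [← GaloisField.card p n hn, Nat.card_eq_fintype_card] at hα
  obtain ⟨a⟩ := Function.Embedding.nonempty_of_card_le hα
  exact ⟨a, a.injective⟩

theorem exists_forall_card_fiber_eq {α β : Type*} [Fintype α] [Fintype β] [DecidableEq β] {η : ℕ}
    (h : Fintype.card α = Fintype.card β * η) : ∃ f : α → β, ∀ b, #{a | f a = b} = η := by
  let e : α ≃ β × Fin η := Fintype.equivOfCardEq (by simpa using h)
  refine ⟨fun a => (e a).1, fun b => ?_⟩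
  calc #{a | (e a).1 = b} = #(({b} : Finset β) ×ˢ (univ : Finset (Fin η))) :=
        card_equiv e fun a => by simp only [mem_filter_univ, mem_product, mem_singleton, mem_univ,
          and_true]
    _ = η := by simp

namespace Network

variable {H K : ℕ} (G : Network H K)

theorem mem_relays {k : Fin K} {i : Fin H} : i ∈ G.relays k ↔ k ∈ G.N i := by
  simp [relays]

theorem mem_usersOf {k : Fin K} {z : ℕ} : k ∈ G.usersOf z ↔ #(G.relays k) = z := by
  simp [usersOf]

theorem sum_card_N : ∑ i, #(G.N i) = ∑ k, #(G.relays k) := by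
  simpa [bipartiteAbove, bipartiteBelow, relays] using
    sum_card_bipartiteAbove_eq_sum_card_bipartiteBelow (s := univ) (t := univ)
      fun i k => k ∈ G.N i

theorem sum_card_N_eq_avgConnectivity_mul :
    ∑ i, (#(G.N i) : ℝ) = G.avgConnectivity * K := by
  have hlinks : ∑ i, (#(G.N i) : ℝ) = ∑ k, (#(G.relays k) : ℝ) := by exact_mod_cast G.sum_card_N
  rw [avgConnectivity, hlinks, div_mul_cancel_of_imp]
  intro hK
  obtain rfl : K = 0 := by exact_mod_cast hK
  simp

theorem card_inter_usersOf_sdiff (z : ℕ) (i j : Fin H) :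
    #((G.N i ∩ G.usersOf z) \ G.N j) =
      #(G.N i ∩ G.usersOf z) - #(G.N i ∩ G.N j ∩ G.usersOf z) := by
  rw [card_sdiff, inter_left_comm, inter_assoc]

theorem card_sdiff_le_upCount (z : ℕ) (i j : Fin H) :
    #((G.N i ∩ G.usersOf z) \ G.N j) ≤ G.upCount z i := by
  rw [card_inter_usersOf_sdiff, upCount]
  exact Nat.sub_le_sub_left (ciInf_le' (fun j => #(G.N i ∩ G.N j ∩ G.usersOf z)) j) _

theorem exists_upCount_eq_card_sdiff (z : ℕ) (i : Fin H) :
    ∃ j, G.upCount z i = #((G.N i ∩ G.usersOf z) \ G.N j) := by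
  have : Nonempty (Fin H) := ⟨i⟩
  obtain ⟨j, hj⟩ := exists_eq_ciInf_of_finite (f := fun j => #(G.N i ∩ G.N j ∩ G.usersOf z))
  exact ⟨j, by rw [card_inter_usersOf_sdiff, hj, upCount]⟩

theorem upCount_le_card_N (z : ℕ) (i : Fin H) : G.upCount z i ≤ #(G.N i) :=
  (Nat.sub_le _ _).trans (card_le_card inter_subset_left)

theorem exists_downCount_eq_card_sdiff (hH : 0 < H) (z : ℕ) :
    ∃ i, G.downCount z = #(G.usersOf z \ G.N i) := by
  have : Nonempty (Fin H) := ⟨⟨0, hH⟩⟩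
  obtain ⟨i, hi⟩ := exists_eq_ciInf_of_finite (f := fun i => #(G.usersOf z ∩ G.N i))
  exact ⟨i, by rw [card_sdiff, inter_comm, hi, downCount]⟩

variable {G}

theorem isFeasible_one_div {r : ℕ} (hr : 1 ≤ r) (h : ∀ k, r ≤ #(G.relays k)) :
    G.IsFeasible fun _ => 1 / (r : ℝ) := by
  have hr' : (1 : ℝ) ≤ r := by exact_mod_cast hr
  refine ⟨fun k => ?_, fun i => ⟨by positivity, (div_le_one (by positivity)).2 hr'⟩⟩
  rw [← mul_sum, sum_boole, one_div_mul_eq_div, one_le_div (by positivity)]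
  exact_mod_cast h k

theorem IsFeasible.le_sum_card_N_mul {α : Fin H → ℝ} (hα : G.IsFeasible α) :
    (K : ℝ) ≤ ∑ i, (#(G.N i) : ℝ) * α i :=
  calc (K : ℝ) = ∑ _k : Fin K, (1 : ℝ) := by simp
    _ ≤ ∑ k, ∑ i, α i * (if k ∈ G.N i then 1 else 0) := sum_le_sum fun k _ => hα.1 k
    _ = ∑ i, (#(G.N i) : ℝ) * α i := by
        rw [sum_comm]
        simp only [← mul_sum, sum_boole, filter_univ_mem, mul_comm]

theorem IsOptimalSplit.objective_eq {z : ℕ} {α β : Fin H → ℝ} (hα : G.IsOptimalSplit z α)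
    (hβ : G.IsOptimalSplit z β) : G.objective z α = G.objective z β :=
  (hα.2 β hβ.1).antisymm (hβ.2 α hα.1)

end Network

namespace Scheme

variable {H K : ℕ} {G : Network H K} {V : ℕ} {φ : (Fin K → Bits V) → (Fin K → Bits V)}
  (S : Scheme G V φ)

theorem upMsg_congr {i : Fin H} {v v' : Fin K → Bits V} (h : ∀ k ∈ G.N i, v k = v' k) :
    S.upMsg v i = S.upMsg v' i :=
  congrArg (S.relayEnc i) (funext fun l => by rw [h l l.2])

theorem eq_of_downMsg_eq (i : Fin H) {v v' : Fin K → Bits V}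
    (hdown : S.downMsg v = S.downMsg v') (hloc : ∀ k ∈ G.N i, v k = v' k) : v = v' :=
  calc v = S.relayDec i (S.downMsg v) (S.localDec i fun l => S.userEnc l (v l)) :=
        (S.relayDec_correct v i).symm
    _ = S.relayDec i (S.downMsg v') (S.localDec i fun l => S.userEnc l (v' l)) := by
        rw [hdown, funext fun l : {k // k ∈ G.N i} => congrArg (S.userEnc l) (hloc l l.2)]
    _ = v' := S.relayDec_correct v' i

theorem card_mul_le_T₀_add (i : Fin H) : K * V ≤ S.T₀ + #(G.N i) * V := by
  simpa using card_mul_le_sum_add_card_mul (G.N i) (fun v (_ : Unit) => S.downMsg v)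
    fun v v' hM => S.eq_of_downMsg_eq i (congrFun hM ())

theorem card_mul_add_T_le (i : Fin H) : K * V + S.T i ≤ ∑ j, S.T j + #(G.N i) * V := by
  have hcut := card_mul_le_sum_add_card_mul (G.N i)
    (fun v (j : {j // j ≠ i}) => S.upMsg v j) fun v v' hM hv => by
      refine S.eq_of_downMsg_eq i (congrArg S.serverEnc (funext fun j => ?_)) hv
      rcases eq_or_ne j i with rfl | hj
      · exact S.upMsg_congr hv
      · exact congrFun hM ⟨j, hj⟩
  rw [Fintype.card_fin] at hcut
  rw [Fintype.sum_eq_add_sum_subtype_ne S.T i]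
  linarith

theorem le_downLoad (hV : 0 < V) (hH : 0 < H) :
    (K : ℝ) - G.avgConnectivity * K / H ≤ S.downLoad := by
  have hV' : (0 : ℝ) < V := by exact_mod_cast hV
  have hH' : (0 : ℝ) < H := by exact_mod_cast hH
  have hcut : ∀ i, (K : ℝ) ≤ S.downLoad + #(G.N i) := fun i => by
    rw [downLoad, div_add' _ _ _ hV'.ne', le_div_iff₀ hV']
    exact_mod_cast S.card_mul_le_T₀_add i
  have hsum := sum_le_sum fun i (_ : i ∈ univ) => hcut i
  rw [sum_add_distrib, G.sum_card_N_eq_avgConnectivity_mul] at hsum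
  simp only [sum_const, card_univ, Fintype.card_fin, nsmul_eq_mul] at hsum
  rw [sub_le_iff_le_add, ← sub_le_iff_le_add', le_div_iff₀ hH']
  linarith

theorem le_upLoad (hV : 0 < V) (hH : 1 < H) :
    (K : ℝ) * (H - G.avgConnectivity) / (H - 1) ≤ S.upLoad := by
  have hV' : (0 : ℝ) < V := by exact_mod_cast hV
  have hH' : (0 : ℝ) < H - 1 := sub_pos.2 (by exact_mod_cast hH)
  have hcut : ∀ i, (K : ℝ) + S.T i / V ≤ S.upLoad + #(G.N i) := fun i => by
    rw [upLoad, div_add' _ _ _ hV'.ne', add_div' _ _ _ hV'.ne', div_le_div_iff_of_pos_right hV']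
    exact_mod_cast S.card_mul_add_T_le i
  have hsum := sum_le_sum fun i (_ : i ∈ univ) => hcut i
  rw [sum_add_distrib, sum_add_distrib, G.sum_card_N_eq_avgConnectivity_mul, ← sum_div,
    ← upLoad] at hsum
  simp only [sum_const, card_univ, Fintype.card_fin, nsmul_eq_mul] at hsum
  rw [div_le_iff₀ hH']
  linarith

end Scheme

theorem Network.mem_lowerBounds_upLoads {H K : ℕ} (G : Network H K) (hH : 1 < H)
    (φ : GlobalUpdate K) :
    (K : ℝ) * (H - G.avgConnectivity) / (H - 1) ∈ lowerBounds (G.upLoads φ) := by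
  rintro _ ⟨_, V, hV, S, rfl, -⟩
  exact S.le_upLoad hV hH

theorem Network.mem_lowerBounds_downLoads {H K : ℕ} (G : Network H K) (hH : 0 < H)
    (φ : GlobalUpdate K) :
    (K : ℝ) - G.avgConnectivity * K / H ∈ lowerBounds (G.downLoads φ) := by
  rintro _ ⟨_, V, hV, S, -, rfl⟩
  exact S.le_downLoad hV hH

namespace Scheme

variable {H K : ℕ} {G : Network H K} {V : ℕ} {φ : (Fin K → Bits V) → (Fin K → Bits V)}

theorem IsCoded.downLoad_eq {S : Scheme G V φ} (hS : S.IsCoded) (hV : 0 < V) :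
    S.downLoad = ∑ z : Round H, (G.downCount z : ℝ) := by
  obtain ⟨P, -, -, lay₀, -⟩ := hS
  have hcard : S.T₀ = ∑ z : Round H, P.q z * G.downCount z * P.b z := by
    simpa using Fintype.card_congr lay₀
  have hT₀ : S.T₀ = ∑ z : Round H, G.downCount z * V :=
    hcard.trans (sum_congr rfl fun z _ => by rw [mul_right_comm, P.size, mul_comm])
  rw [downLoad, hT₀, ← sum_mul, Nat.cast_mul, mul_div_cancel_right₀ _ (by positivity),
    Nat.cast_sum]

theorem IsCoded.exists_upLoad_eq {S : Scheme G V φ} (hS : S.IsCoded) (hV : 0 < V) :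
    ∃ α : Round H → Fin H → ℝ, (∀ z : Round H, G.IsOptimalSplit z (α z)) ∧
      S.upLoad = ∑ z : Round H, G.objective z (α z) := by
  obtain ⟨P, -, hup, -⟩ := hS
  refine ⟨P.α, P.optimal, ?_⟩
  have hT : ∀ i, (S.T i : ℝ) / V = ∑ z : Round H, G.upCount z i * P.α z i := fun i => by
    obtain ⟨lay, -⟩ := hup i
    have hcard : S.T i = ∑ z : Round H, G.upCount z i * (P.s z i * P.b z) := by
      simpa using Fintype.card_congr lay
    have hsize : ∀ z, (P.q z : ℝ) * P.b z = V := fun z => by exact_mod_cast P.size z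
    rw [div_eq_iff (by positivity), hcard, sum_mul]
    push_cast [P.seg_size]
    exact sum_congr rfl fun z _ => by rw [← hsize z]; ring
  simp only [upLoad, sum_div, hT, Network.objective]
  exact sum_comm

/-- The scheme in which users send their IVs uncoded, relay `i` sends `up i` of the IVs of its
users and the server broadcasts `down` of the relays' messages. Every relay determines all IVs by
inverting the injective map `h i`, and forwards the updated models to its users. -/
noncomputable def ofInjective (φ : (Fin K → Bits V) → (Fin K → Bits V)) {T : Fin H → ℕ} {T₀ : ℕ}
    (up : (i : Fin H) → ({k // k ∈ G.N i} → Bits V) → Bits (T i))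
    (down : ((i : Fin H) → Bits (T i)) → Bits T₀)
    (h : ∀ i, Function.Injective fun v : Fin K → Bits V =>
      (down fun j => up j ((G.N j).restrict v), (G.N i).restrict v)) : Scheme G V φ where
  TU _ := V
  T := T
  T₀ := T₀
  TE _ := K * V
  loc := G.N
  loc_subset _ := subset_rfl
  userEnc _ x := x
  localDec _ w := w
  relayEnc := up
  serverEnc := down
  relayDec i x w := Function.invFun (fun v : Fin K → Bits V =>
    (down fun j => up j ((G.N j).restrict v), (G.N i).restrict v)) (x, w)
  relayDownEnc i x w t := φ (Function.invFun (fun v : Fin K → Bits V =>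
    (down fun j => up j ((G.N j).restrict v), (G.N i).restrict v)) (x, w))
      (finProdFinEquiv.symm t).1 (finProdFinEquiv.symm t).2
  userDec k w t := w ⟨(G.cover k).choose, (G.cover k).choose_spec⟩ (finProdFinEquiv (k, t))
  localDec_correct _ _ _ := rfl
  relayDec_correct v i := Function.leftInverse_invFun (h i) v
  userDec_correct v k := funext fun t => by
    have hdec := Function.leftInverse_invFun (h (G.cover k).choose) v
    simp only [Equiv.symm_apply_apply]
    exact congrArg (fun v => φ v k t) hdec

end Scheme

namespace CodingParams

variable {H K : ℕ} {G : Network H K} {V : ℕ} (P : CodingParams G V)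

/-- The message that carries one symbol `y z j` for every round `z` and every `j : ι z`, its bits
being listed in the order of `Fintype.equivFin`. -/
noncomputable def toBits {ι : Round H → Type*} [∀ z, Fintype (ι z)]
    (y : (z : Round H) → ι z → GaloisField 2 (P.b z)) :
    Bits (Fintype.card (Σ z, ι z × Fin (P.b z))) :=
  (fun x : Σ z, ι z × Fin (P.b z) => (P.ident x.1).symm (y x.1 x.2.1) x.2.2) ∘
    (Fintype.equivFin _).symm

/-- The symbols carried by a message that is laid out as by `toBits`. -/
noncomputable def ofBits {ι : Round H → Type*} [∀ z, Fintype (ι z)]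
    (x : Bits (Fintype.card (Σ z, ι z × Fin (P.b z)))) (z : Round H) (j : ι z) :
    GaloisField 2 (P.b z) :=
  P.ident z fun u => x (Fintype.equivFin _ ⟨z, j, u⟩)

theorem ofBits_toBits {ι : Round H → Type*} [∀ z, Fintype (ι z)]
    (y : (z : Round H) → ι z → GaloisField 2 (P.b z)) : P.ofBits (P.toBits y) = y := by
  funext z j
  have hbit : ∀ u, P.toBits y (Fintype.equivFin _ ⟨z, j, u⟩) = (P.ident z).symm (y z j) u :=
    fun u => by rw [toBits, Function.comp_apply, Equiv.symm_apply_apply]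
  rw [ofBits, funext hbit]
  exact (P.ident z).apply_symm_apply (y z j)

theorem symbol_injective (z : Round H) : Function.Injective (P.symbol z) := by
  intro x y h
  funext t
  obtain ⟨⟨p, u⟩, hpu⟩ := finProdFinEquiv.surjective (Fin.cast (P.size z).symm t)
  simpa [hpu] using congrFun ((P.ident z).injective (congrFun h p)) u

theorem upSymbol_congr {v v' : Fin K → Bits V} {i : Fin H} (h : ∀ k ∈ G.N i, v k = v' k)
    (z : Round H) : P.upSymbol v z i = P.upSymbol v' z i := by
  funext j t
  exact sum_congr rfl fun k hk => by rw [h k (mem_inter.1 hk).1]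

/-- The message of relay `i` to the server in the coded scheme, given the IVs of its users. -/
noncomputable def upEnc (i : Fin H) (w : {k // k ∈ G.N i} → Bits V) :
    Bits (Fintype.card (Σ z : Round H, (Fin (G.upCount z i) × Fin (P.s z i)) × Fin (P.b z))) :=
  P.toBits fun z jt => P.upSymbol (Function.extend Subtype.val w 0) z i jt.1 jt.2

/-- The message broadcast by the server in the coded scheme, given the messages of the relays. -/
noncomputable def downEnc (X : (i : Fin H) →
      Bits (Fintype.card (Σ z : Round H, (Fin (G.upCount z i) × Fin (P.s z i)) × Fin (P.b z)))) :
    Bits (Fintype.card (Σ z : Round H, Fin (P.q z * G.downCount z) × Fin (P.b z))) :=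
  P.toBits fun z n => ∑ i, ∑ j, ∑ t, P.d z n i j t * P.ofBits (X i) z (j, t)

theorem ofBits_upEnc (v : Fin K → Bits V) (i : Fin H) (z : Round H) (j : Fin (G.upCount z i))
    (t : Fin (P.s z i)) :
    P.ofBits (P.upEnc i ((G.N i).restrict v)) z (j, t) = P.upSymbol v z i j t := by
  rw [upEnc, ofBits_toBits, P.upSymbol_congr]
  exact fun k hk => Subtype.val_injective.extend_apply ((G.N i).restrict v) 0 ⟨k, hk⟩

theorem ofBits_downEnc (v : Fin K → Bits V) :
    P.ofBits (P.downEnc fun i => P.upEnc i ((G.N i).restrict v)) = P.downSymbol v := by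
  rw [downEnc, ofBits_toBits]
  funext z n
  simp only [ofBits_upEnc, downSymbol]

/-- Every relay can recover all IVs from its local IVs and the symbols broadcast by the server, so
that the coefficients `c` and `d` are suitable for the coded scheme. -/
def Decodable : Prop :=
  ∀ (i : Fin H) (v v' : Fin K → Bits V), (∀ k ∈ G.N i, v k = v' k) →
    P.downSymbol v = P.downSymbol v' → v = v'

variable {P}

theorem Decodable.injective_downEnc_restrict (hP : P.Decodable) (i : Fin H) :
    Function.Injective fun v : Fin K → Bits V =>
      (P.downEnc fun j => P.upEnc j ((G.N j).restrict v), (G.N i).restrict v) := fun v v' h => by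
  obtain ⟨hdown, hloc⟩ := Prod.ext_iff.1 h
  refine hP i v v' (fun k hk => congrFun hloc ⟨k, hk⟩) ?_
  rw [← P.ofBits_downEnc, ← P.ofBits_downEnc]
  exact congrArg P.ofBits hdown

theorem Decodable.exists_isCoded (hP : P.Decodable) (φ : (Fin K → Bits V) → (Fin K → Bits V)) :
    ∃ S : Scheme G V φ, S.IsCoded :=
  ⟨.ofInjective φ P.upEnc P.downEnc hP.injective_downEnc_restrict, P,
    ⟨fun _ => rfl, fun _ _ _ => rfl⟩,
    fun i => ⟨(Fintype.equivFin _).symm.trans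
      (Equiv.sigmaCongrRight fun _ => Equiv.prodAssoc _ _ _), fun v => P.ofBits_upEnc v i⟩,
    (Fintype.equivFin _).symm, fun v => congrFun₂ (P.ofBits_downEnc v)⟩

variable (P) in
/-- In every round, the coefficients of each relay and those of the server are the rows of
Vandermonde matrices with pairwise distinct nodes, indexed by the users and by the symbols sent by
the relays, respectively. -/
def IsVandermonde : Prop :=
  ∀ z : Round H,
    (∃ a : Fin K → GaloisField 2 (P.b z), Function.Injective a ∧
      ∀ i j k, P.c z i j k = a k ^ (j : ℕ)) ∧
    ∃ a : (Σ i : Fin H, Fin (G.upCount z i) × Fin (P.s z i)) → GaloisField 2 (P.b z),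
      Function.Injective a ∧ ∀ n i j t, P.d z n i j t = a ⟨i, j, t⟩ ^ (n : ℕ)

theorem IsVandermonde.upSymbol_eq (hP : P.IsVandermonde) {z : Round H} {l : Fin H}
    (hcount : ∑ i ∈ univ.erase l, G.upCount z i * P.s z i ≤ P.q z * G.downCount z)
    {v v' : Fin K → Bits V} (hl : ∀ k ∈ G.N l, v k = v' k)
    (h : P.downSymbol v z = P.downSymbol v' z) : P.upSymbol v z = P.upSymbol v' z := by
  obtain ⟨-, a, ha, hd⟩ := hP z
  funext i j t
  refine eq_of_forall_sum_pow_mul_eq (S := univ) (E := (univ.erase l).sigma fun _ => univ)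
    ha.injOn (by simpa using hcount) (x := fun p => P.upSymbol v z p.1 p.2.1 p.2.2)
    (y := fun p => P.upSymbol v' z p.1 p.2.1 p.2.2) (fun p _ hp => ?_) (fun n => ?_)
    ⟨i, j, t⟩ (mem_univ _)
  · obtain ⟨i, j, t⟩ := p
    obtain rfl : i = l := by simpa using hp
    rw [P.upSymbol_congr hl]
  · simpa only [downSymbol, hd, Fintype.sum_sigma, Fintype.sum_prod_type] using congrFun h n

theorem IsVandermonde.symbol_seg_eq (hP : P.IsVandermonde) {z : Round H} {i l : Fin H}
    {v v' : Fin K → Bits V} (hl : ∀ k ∈ G.N l, v k = v' k)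
    (h : P.upSymbol v z i = P.upSymbol v' z i) (t : Fin (P.s z i)) :
    ∀ k ∈ G.N i ∩ G.usersOf z,
      P.symbol z (v k) (P.seg z k i t) = P.symbol z (v' k) (P.seg z k i t) := by
  obtain ⟨⟨a, ha, hc⟩, -⟩ := hP z
  refine eq_of_forall_sum_pow_mul_eq ha.injOn (G.card_sdiff_le_upCount z i l)
    (fun k hk hkl => ?_) fun j => ?_
  · have hk : k ∈ G.N l := by
      by_contra hn
      exact hkl (mem_sdiff.2 ⟨hk, hn⟩)
    rw [hl k hk]
  · simpa only [upSymbol, hc] using congrFun₂ h j t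

theorem IsVandermonde.decodable (hP : P.IsVandermonde)
    (hcount : ∀ (z : Round H) (l : Fin H),
      ∑ i ∈ univ.erase l, G.upCount z i * P.s z i ≤ P.q z * G.downCount z) :
    P.Decodable := by
  intro l v v' hl hdown
  funext k
  by_cases hkl : k ∈ G.N l
  · exact hl k hkl
  have hlower : 0 < #(G.relays k) :=
    card_pos.2 ((G.cover k).imp fun i hi => G.mem_relays.2 hi)
  have hupper : #(G.relays k) < H := by
    simpa using card_lt_univ_of_notMem (mt G.mem_relays.1 hkl)
  let z : Round H := ⟨#(G.relays k), mem_Icc.2 ⟨hlower, Nat.le_sub_one_of_lt hupper⟩⟩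
  have hkz : k ∈ G.usersOf z := G.mem_usersOf.2 rfl
  have hup := hP.upSymbol_eq (hcount z l) hl (congrFun hdown z)
  refine P.symbol_injective z (funext fun p => ?_)
  obtain ⟨i, hki, t, rfl⟩ := P.seg_cover z k hkz p
  exact hP.symbol_seg_eq hl (congrFun hup i) t k (mem_inter.2 ⟨hki, hkz⟩)

end CodingParams

namespace Network

variable {H K : ℕ}

/-- The network in which user `k` is connected exactly to the relays in `f k`. -/
def ofRelays (f : Fin K → Finset (Fin H)) (hf : ∀ k, (f k).Nonempty) (hf' : ∀ i, ∃ k, i ∉ f k) :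
    Network H K where
  N i := {k | i ∈ f k}
  cover k := (hf k).imp fun i hi => by simpa using hi
  nontrivial i h := by
    obtain ⟨k, hk⟩ := hf' i
    have hki := h.ge (mem_univ k)
    exact hk (by simpa using hki)

theorem relays_ofRelays (f : Fin K → Finset (Fin H)) (hf : ∀ k, (f k).Nonempty)
    (hf' : ∀ i, ∃ k, i ∉ f k) : (ofRelays f hf hf').relays = f := by
  ext k i
  simp [mem_relays, ofRelays]

theorem exists_isSymmetricDesign {r : ℕ} (hr : 1 ≤ r) (hrH : r < H) (hK : 0 < K)
    (hdvd : H.choose r ∣ K) : ∃ G : Network H K, G.IsSymmetricDesign r := by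
  obtain ⟨η, rfl⟩ := hdvd
  have hη : 0 < η := Nat.pos_of_mul_pos_left hK
  obtain ⟨f, hf⟩ := exists_forall_card_fiber_eq (α := Fin (H.choose r * η))
    (β := {T : Finset (Fin H) // #T = r}) (η := η) (by simp)
  have hne : ∀ k, (f k).1.Nonempty := fun k => card_pos.1 ((f k).2.symm ▸ hr)
  have hmiss : ∀ i, ∃ k, i ∉ (f k).1 := fun i => by
    obtain ⟨T, hT, hTr⟩ := exists_subset_card_eq (s := univ.erase i) (n := r)
      (by simpa using Nat.le_sub_one_of_lt hrH)
    obtain ⟨k, hk⟩ := card_pos.1 (hη.trans_eq (hf ⟨T, hTr⟩).symm)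
    exact ⟨k, fun hi => notMem_erase i univ (hT (by rwa [(mem_filter.1 hk).2] at hi))⟩
  refine ⟨ofRelays (fun k => (f k).1) hne hmiss, fun k => ?_, η, hη, fun T hT => ?_⟩
  · rw [relays_ofRelays, (f k).2]
  · simpa only [relays_ofRelays, Subtype.ext_iff] using hf ⟨T, hT⟩

theorem exists_seg_cover {G : Network H K} {r : ℕ} (hr : 0 < r) (h : ∀ k, #(G.relays k) = r) :
    ∃ seg : Fin K → Fin H → Fin r, ∀ k p, ∃ i, k ∈ G.N i ∧ seg k i = p := by
  let e k := equivFinOfCardEq (h k)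
  refine ⟨fun k => Function.extend Subtype.val (e k) fun _ => ⟨0, hr⟩, fun k p => ?_⟩
  exact ⟨(e k).symm p, G.mem_relays.1 ((e k).symm p).2,
    (Subtype.val_injective.extend_apply _ _ _).trans ((e k).apply_symm_apply p)⟩

end Network

namespace Network.IsSymmetricDesign

variable {H K r : ℕ} {G : Network H K}

theorem avgConnectivity_eq (h : G.IsSymmetricDesign r) (hK : 0 < K) : G.avgConnectivity = r := by
  have hK' : (K : ℝ) ≠ 0 := by positivity
  simp [avgConnectivity, h.1, hK']

theorem choose_mul_card_filter_relays_mem (h : G.IsSymmetricDesign r)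
    {𝒯 : Finset (Finset (Fin H))} (h𝒯 : 𝒯 ⊆ powersetCard r univ) :
    H.choose r * #{k | G.relays k ∈ 𝒯} = K * #𝒯 := by
  obtain ⟨hcard, η, -, hη⟩ := h
  have hfiber : ∀ 𝒯 ⊆ powersetCard r univ, #{k | G.relays k ∈ 𝒯} = #𝒯 * η := fun 𝒯 h𝒯 => by
    rw [← sum_card_fiberwise_eq_card_filter,
      sum_const_nat fun T hT => hη T (mem_powersetCard_univ.1 (h𝒯 hT))]
  have hK : K = H.choose r * η := by simpa [hcard] using hfiber _ subset_rfl
  rw [hfiber 𝒯 h𝒯, hK]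
  ring

theorem descFactorial_mul_card_filter_subset_relays (h : G.IsSymmetricDesign r) (hrH : r ≤ H)
    (s : Finset (Fin H)) :
    H.descFactorial #s * #{k | s ⊆ G.relays k} = K * r.descFactorial #s := by
  rcases le_or_gt #s r with hs | hs
  · have hfilter : H.choose r * #{k | s ⊆ G.relays k} = K * (H - #s).choose (r - #s) := by
      have hsuperset := card_filter_powersetCard_subset s univ r (subset_univ s) hs
      rw [card_univ, Fintype.card_fin] at hsuperset
      rw [← hsuperset, ← h.choose_mul_card_filter_relays_mem (filter_subset _ _)]
      simp [h.1]
    refine Nat.eq_of_mul_eq_mul_left (Nat.choose_pos hrH) ?_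
    rw [mul_left_comm, hfilter, Nat.descFactorial_eq_factorial_mul_choose,
      Nat.descFactorial_eq_factorial_mul_choose]
    linear_combination K * (#s).factorial * (Nat.choose_mul (n := H) hs).symm
  · have hempty : ({k | s ⊆ G.relays k} : Finset (Fin K)) = ∅ :=
      filter_eq_empty_iff.2 fun k _ hk => (card_le_card hk).not_gt (by rwa [h.1])
    rw [hempty, card_empty, Nat.descFactorial_of_lt hs, mul_zero, mul_zero]

theorem cast_card_N (h : G.IsSymmetricDesign r) (hrH : r ≤ H) (i : Fin H) :
    (#(G.N i) : ℝ) = r * K / H := by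
  have hH : (H : ℝ) ≠ 0 := by exact_mod_cast i.pos.ne'
  have hcount := h.descFactorial_mul_card_filter_subset_relays hrH {i}
  simp only [card_singleton, Nat.descFactorial_one, singleton_subset_iff, mem_relays,
    filter_univ_mem] at hcount
  rw [eq_div_iff hH]
  exact_mod_cast show #(G.N i) * H = r * K by linarith

theorem cast_card_sdiff (h : G.IsSymmetricDesign r) (hrH : r ≤ H) {i j : Fin H} (hij : i ≠ j) :
    (#(G.N i \ G.N j) : ℝ) = (H - r) / (H - 1) * #(G.N i) := by
  have hH1 : (1 : ℝ) < H := by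
    exact_mod_cast Fin.nontrivial_iff_two_le.1 ⟨i, j, hij⟩
  have hcount := h.descFactorial_mul_card_filter_subset_relays hrH {i, j}
  simp only [card_pair hij, insert_subset_iff, singleton_subset_iff, mem_relays, filter_and,
    filter_univ_mem] at hcount
  have hinter : (H * (H - 1) : ℝ) * #(G.N i ∩ G.N j) = K * (r * (r - 1)) := by
    rw [← Nat.cast_descFactorial_two, ← Nat.cast_descFactorial_two]
    exact_mod_cast hcount
  have hsplit : (#(G.N i \ G.N j) + #(G.N i ∩ G.N j) : ℝ) = #(G.N i) := by
    exact_mod_cast card_sdiff_add_card_inter (G.N i) (G.N j)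
  have hH0 : (H : ℝ) ≠ 0 := by positivity
  have hH1' : (H : ℝ) - 1 ≠ 0 := (sub_pos.2 hH1).ne'
  have hN := (eq_div_iff hH0).1 (h.cast_card_N hrH i)
  rw [div_mul_eq_mul_div, eq_div_iff hH1', ← mul_right_inj' hH0]
  linear_combination (H * (H - 1) : ℝ) * hsplit - hinter + (r - 1 : ℝ) * hN

theorem usersOf_self (h : G.IsSymmetricDesign r) : G.usersOf r = univ := by
  simp [usersOf, h.1]

theorem usersOf_of_ne (h : G.IsSymmetricDesign r) {z : ℕ} (hz : z ≠ r) : G.usersOf z = ∅ := by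
  simp [usersOf, h.1, hz.symm]

theorem upCount_of_ne (h : G.IsSymmetricDesign r) {z : ℕ} (hz : z ≠ r) (i : Fin H) :
    G.upCount z i = 0 := by
  simp [upCount, h.usersOf_of_ne hz]

theorem downCount_of_ne (h : G.IsSymmetricDesign r) {z : ℕ} (hz : z ≠ r) :
    G.downCount z = 0 := by
  simp [downCount, h.usersOf_of_ne hz]

theorem cast_upCount_self (h : G.IsSymmetricDesign r) (hr : 1 ≤ r) (hrH : r < H) (i : Fin H) :
    (G.upCount r i : ℝ) = (H - r) / (H - 1) * #(G.N i) := by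
  have : Nontrivial (Fin H) := Fin.nontrivial_iff_two_le.2 (by omega)
  obtain ⟨j, hj⟩ := exists_ne i
  rw [← h.cast_card_sdiff hrH.le hj.symm]
  refine le_antisymm ?_ ?_
  · obtain ⟨l, hl⟩ := G.exists_upCount_eq_card_sdiff r i
    rw [h.usersOf_self, inter_univ] at hl
    rcases eq_or_ne i l with rfl | hil
    · simp [hl]
    · rw [hl, h.cast_card_sdiff hrH.le hil, h.cast_card_sdiff hrH.le hj.symm]
  · have hle := G.card_sdiff_le_upCount r i j
    rw [h.usersOf_self, inter_univ] at hle
    exact_mod_cast hle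

theorem cast_downCount_self (h : G.IsSymmetricDesign r) (hrH : r < H) :
    (G.downCount r : ℝ) = K - r * K / H := by
  obtain ⟨i, hi⟩ := G.exists_downCount_eq_card_sdiff (by omega) r
  rw [hi, h.usersOf_self, ← compl_eq_univ_sdiff, card_compl,
    Nat.cast_sub (card_le_univ _), h.cast_card_N hrH.le, Fintype.card_fin]

theorem objective_self (h : G.IsSymmetricDesign r) (hr : 1 ≤ r) (hrH : r < H)
    (α : Fin H → ℝ) :
    G.objective r α = (H - r) / (H - 1) * ∑ i, (#(G.N i) : ℝ) * α i := by
  simp only [objective, h.cast_upCount_self hr hrH, mul_assoc, mul_sum]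

theorem objective_of_ne (h : G.IsSymmetricDesign r) {z : ℕ} (hz : z ≠ r) (α : Fin H → ℝ) :
    G.objective z α = 0 := by
  simp [objective, h.upCount_of_ne hz]

theorem objective_self_one_div (h : G.IsSymmetricDesign r) (hr : 1 ≤ r) (hrH : r < H) :
    (G.objective r fun _ => 1 / (r : ℝ)) = (H - r) / (H - 1) * K := by
  have hlinks : ∑ i, (#(G.N i) : ℝ) = K * r := by
    exact_mod_cast G.sum_card_N.trans (by simp [h.1])
  rw [h.objective_self hr hrH, ← sum_mul, hlinks, mul_assoc (K : ℝ),
    mul_one_div_cancel (by positivity), mul_one]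

theorem isOptimalSplit_one_div (h : G.IsSymmetricDesign r) (hr : 1 ≤ r) (hrH : r < H)
    (z : ℕ) : G.IsOptimalSplit z fun _ => 1 / (r : ℝ) := by
  refine ⟨isFeasible_one_div hr fun k => (h.1 k).ge, fun α hα => ?_⟩
  rcases eq_or_ne z r with rfl | hz
  · rw [h.objective_self_one_div hr hrH, h.objective_self hr hrH]
    have hH : (1 : ℝ) ≤ H := by exact_mod_cast (by omega : 1 ≤ H)
    have hzH : (z : ℝ) ≤ H := by exact_mod_cast hrH.le
    exact mul_le_mul_of_nonneg_left hα.le_sum_card_N_mul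
      (div_nonneg (sub_nonneg.2 hzH) (sub_nonneg.2 hH))
  · rw [h.objective_of_ne hz, h.objective_of_ne hz]

theorem upLoad_eq_of_isCoded (h : G.IsSymmetricDesign r) (hr : 1 ≤ r) (hrH : r < H) {V : ℕ}
    (hV : 0 < V) {φ : (Fin K → Bits V) → (Fin K → Bits V)} {S : Scheme G V φ} (hS : S.IsCoded) :
    S.upLoad = (K : ℝ) * (H - r) / (H - 1) := by
  let ρ : Round H := ⟨r, mem_Icc.2 ⟨hr, Nat.le_sub_one_of_lt hrH⟩⟩
  obtain ⟨α, hα, hload⟩ := hS.exists_upLoad_eq hV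
  calc S.upLoad = G.objective ρ (α ρ) := hload.trans <| Fintype.sum_eq_single ρ fun z hz =>
        h.objective_of_ne (fun hzr => hz (Subtype.ext hzr)) _
    _ = G.objective r fun _ => 1 / (r : ℝ) :=
        (hα ρ).objective_eq (h.isOptimalSplit_one_div hr hrH r)
    _ = (K : ℝ) * (H - r) / (H - 1) := by
        rw [h.objective_self_one_div hr hrH, div_mul_eq_mul_div, mul_comm]

theorem downLoad_eq_of_isCoded (h : G.IsSymmetricDesign r) (hr : 1 ≤ r) (hrH : r < H) {V : ℕ}
    (hV : 0 < V) {φ : (Fin K → Bits V) → (Fin K → Bits V)} {S : Scheme G V φ} (hS : S.IsCoded) :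
    S.downLoad = (K : ℝ) - r * K / H := by
  let ρ : Round H := ⟨r, mem_Icc.2 ⟨hr, Nat.le_sub_one_of_lt hrH⟩⟩
  rw [hS.downLoad_eq hV, Fintype.sum_eq_single ρ fun z hz => ?_, h.cast_downCount_self hrH]
  rw [h.downCount_of_ne fun hzr => hz (Subtype.ext hzr), Nat.cast_zero]

theorem sum_erase_upCount (h : G.IsSymmetricDesign r) (hr : 1 ≤ r) (hrH : r < H) (z : ℕ)
    (l : Fin H) : ∑ i ∈ univ.erase l, G.upCount z i = r * G.downCount z := by
  rcases eq_or_ne z r with rfl | hz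
  · have hH1 : (H : ℝ) - 1 ≠ 0 := by
      have : (1 : ℝ) < H := by exact_mod_cast (by omega : 1 < H)
      linarith
    have hH : (H : ℝ) ≠ 0 := by exact_mod_cast l.pos.ne'
    have hcast : ∑ i ∈ univ.erase l, (G.upCount z i : ℝ) = z * G.downCount z := by
      simp only [h.cast_upCount_self hr hrH, h.cast_card_N hrH.le, h.cast_downCount_self hrH,
        sum_const, card_erase_of_mem (mem_univ l), card_univ, Fintype.card_fin, nsmul_eq_mul]
      rw [Nat.cast_pred l.pos]
      field_simp
    exact_mod_cast hcast
  · simp [h.upCount_of_ne hz, h.downCount_of_ne hz]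

theorem exists_codingParams (h : G.IsSymmetricDesign r) (hr : 1 ≤ r) (hrH : r < H) {m : ℕ}
    (hm : m ≠ 0) (hKm : r * K ≤ 2 ^ m) :
    ∃ P : CodingParams G (r * m), P.IsVandermonde ∧ (∀ z, P.q z = r) ∧ ∀ z i, P.s z i = 1 := by
  have hlinks : ∑ i, #(G.N i) = r * K := G.sum_card_N.trans (by simp [h.1, mul_comm])
  obtain ⟨a, ha⟩ := exists_injective_galoisField (α := Fin K) (p := 2) hm
    (by simpa using (Nat.le_mul_of_pos_left K hr).trans hKm)
  choose a' ha' using fun z : Round H => exists_injective_galoisField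
    (α := Σ i : Fin H, Fin (G.upCount z i) × Fin 1) (p := 2) hm (by
      simpa using (sum_le_sum fun i _ => G.upCount_le_card_N z i).trans (hlinks.trans_le hKm))
  obtain ⟨seg, hseg⟩ := exists_seg_cover hr h.1
  let P : CodingParams G (r * m) :=
    { α := fun _ _ => 1 / r
      optimal := fun z => h.isOptimalSplit_one_div hr hrH z
      q := fun _ => r
      b := fun _ => m
      size := fun _ => rfl
      s := fun _ _ => 1
      seg_size := fun _ _ => by rw [one_div_mul_cancel (by positivity), Nat.cast_one]
      ident := fun _ => LinearEquiv.ofFinrankEq _ _ (by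
        rw [GaloisField.finrank 2 hm, Module.finrank_fin_fun])
      seg := fun _ k i _ => seg k i
      seg_cover := fun _ k _ p => (hseg k p).imp fun _ hi => ⟨hi.1, 0, hi.2⟩
      c := fun _ _ j k => a k ^ (j : ℕ)
      d := fun z n i j t => a' z ⟨i, j, t⟩ ^ (n : ℕ) }
  exact ⟨P, fun z => ⟨⟨a, ha, fun _ _ _ => rfl⟩, a' z, ha' z, fun _ _ _ _ => rfl⟩,
    fun _ => rfl, fun _ _ => rfl⟩

theorem exists_isCoded (h : G.IsSymmetricDesign r) (hr : 1 ≤ r) (hrH : r < H) {m : ℕ}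
    (hm : m ≠ 0) (hKm : r * K ≤ 2 ^ m)
    (φ : (Fin K → Bits (r * m)) → (Fin K → Bits (r * m))) :
    ∃ S : Scheme G (r * m) φ, S.IsCoded := by
  obtain ⟨P, hP, hq, hs⟩ := h.exists_codingParams hr hrH hm hKm
  refine (hP.decodable fun z l => ?_).exists_isCoded φ
  simpa only [hs, hq, mul_one] using (h.sum_erase_upCount hr hrH z l).le

theorem achievable (h : G.IsSymmetricDesign r) (hr : 1 ≤ r) (hrH : r < H) (hK : 0 < K)
    (φ : GlobalUpdate K) :
    G.Achievable φ ((K : ℝ) * (H - r) / (H - 1)) ((K : ℝ) - r * K / H) := by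
  have hrK : 0 < r * K := Nat.mul_pos hr hK
  have hV : 0 < r * (r * K) := Nat.mul_pos hr hrK
  obtain ⟨S, hS⟩ := h.exists_isCoded hr hrH hrK.ne' Nat.lt_two_pow_self.le (φ _)
  exact ⟨_, hV, S, h.upLoad_eq_of_isCoded hr hrH hV hS, h.downLoad_eq_of_isCoded hr hrH hV hS⟩

end Network.IsSymmetricDesign

theorem theorem3 (H K r : ℕ) (hr : 1 ≤ r) (hrH : r < H) (hK : 0 < K) (hdvd : H.choose r ∣ K) :
    (∃ G : Network H K, G.IsSymmetricDesign r) ∧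
    ∀ G : Network H K, G.IsSymmetricDesign r →
      G.avgConnectivity = r ∧
      ∀ φ : GlobalUpdate K,
        -- the coded scheme exists for all sufficiently large IV sizes divisible by `r`
        (∃ m₀ : ℕ, ∀ m : ℕ, m₀ ≤ m → ∃ S : Scheme G (r * m) (φ (r * m)), S.IsCoded) ∧
        -- its loads
        (∀ V : ℕ, 0 < V → ∀ S : Scheme G V (φ V), S.IsCoded →
          S.upLoad = (K : ℝ) * ((H : ℝ) - r) / ((H : ℝ) - 1) ∧
          S.downLoad = (K : ℝ) - (r : ℝ) * K / H) ∧
        -- both loads are achieved at the same time and are optimal for this network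
        G.Achievable φ ((K : ℝ) * ((H : ℝ) - r) / ((H : ℝ) - 1)) ((K : ℝ) - (r : ℝ) * K / H) ∧
        IsLeast (G.upLoads φ) ((K : ℝ) * ((H : ℝ) - r) / ((H : ℝ) - 1)) ∧
        IsLeast (G.downLoads φ) ((K : ℝ) - (r : ℝ) * K / H) ∧
        -- they are optimal among all networks with average user connectivity `r`
        IsLeast {L : ℝ | ∃ G' : Network H K, G'.avgConnectivity = r ∧ L ∈ G'.upLoads φ}
          ((K : ℝ) * ((H : ℝ) - r) / ((H : ℝ) - 1)) ∧
        IsLeast {L : ℝ | ∃ G' : Network H K, G'.avgConnectivity = r ∧ L ∈ G'.downLoads φ}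
          ((K : ℝ) - (r : ℝ) * K / H) := by
  refine ⟨Network.exists_isSymmetricDesign hr hrH hK hdvd, fun G hG => ?_⟩
  have hconn := hG.avgConnectivity_eq hK
  refine ⟨hconn, fun φ => ?_⟩
  have hach := hG.achievable hr hrH hK φ
  have hup : ∀ G' : Network H K, G'.avgConnectivity = r →
      (K : ℝ) * (H - r) / (H - 1) ∈ lowerBounds (G'.upLoads φ) :=
    fun G' hG' => hG' ▸ G'.mem_lowerBounds_upLoads (hr.trans_lt hrH) φ
  have hdown : ∀ G' : Network H K, G'.avgConnectivity = r →
      (K : ℝ) - r * K / H ∈ lowerBounds (G'.downLoads φ) :=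
    fun G' hG' => hG' ▸ G'.mem_lowerBounds_downLoads (hr.trans hrH.le) φ
  exact ⟨⟨r * K, fun m hm => hG.exists_isCoded hr hrH
      ((Nat.mul_pos hr hK).trans_le hm).ne' (hm.trans Nat.lt_two_pow_self.le) _⟩,
    fun V hV S hS => ⟨hG.upLoad_eq_of_isCoded hr hrH hV hS, hG.downLoad_eq_of_isCoded hr hrH hV hS⟩,
    hach, ⟨⟨_, hach⟩, hup G hconn⟩, ⟨⟨_, hach⟩, hdown G hconn⟩,
    ⟨⟨G, hconn, _, hach⟩, fun _ ⟨G', hG', hL⟩ => hup G' hG' hL⟩,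
    ⟨⟨G, hconn, _, hach⟩, fun _ ⟨G', hG', hL⟩ => hdown G' hG' hL⟩⟩
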